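/- Consider a network with $J$ resources of unit capacity and $K$ job classes. Class $i$ jobs arrive as a Poisson process of rate $\lambda_i>0$, all rates being equal, $\lambda_i=\lambda$; a class $i$ job uses a nonempty set $r_i$ of resources, requires at each $j\in r_i$ an exponential workload of mean $1/\mu_j$, and has cost $c_i>0$ per unit of time. Put $\rho_{ij}=\lambda_i/\mu_j$ and $\rho_j=\sum_{i:j\in r_i}\rho_{ij}$, and assume $\rho_j<1$ for all $j$. For positive bids $\boldsymbol\beta=(\beta_{ij})_{j\in r_i}$ of the classes, the heavy traffic processing time at resource $j$ of a single job with bid $x>0$ is \[ V_j^{HT}(x;\boldsymbol\beta^{(j)})=\frac{1}{1-\rho_j}\cdot\frac{1}{\mu_j\,x\,\gamma_j},\qquad \gamma_j=\frac1{\rho_j}\sum_{i:j\in r_i}\frac{\rho_{ij}}{\beta_{ij}},\qquad \boldsymbol\beta^{(j)}=(\beta_{ij})_{i:j\in r_i}, \] and $b_j(v;\boldsymbol\beta^{(j)})$ denotes the bid $x>0$ with $V_j^{HT}(x;\boldsymbol\beta^{(j)})=v$. A heavy traffic equilibrium (HTE) of the network game (with payments equal to the bids, i.e. $\alpha=1$)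 is a positive $\boldsymbol\beta^*$ such that for every $i$ the vector $(\beta^*_{ij})_{j\in r_i}$ minimizes \[ c_i\max_{j\in r_i}V_j^{HT}(x_j;\boldsymbol\beta^{*(j)})+\sum_{j\in r_i}x_j \] over all $(x_j)_{j\in r_i}$ with $x_j>0$. Let $\boldsymbol\beta^*$ be an HTE, $V_{ij}^*=V_j^{HT}(\beta_{ij}^*;\boldsymbol\beta^{*(j)})$ and $b'_{ij}=\frac{\partial b_j}{\partial v}(V_{ij}^*;\boldsymbol\beta^{*(j)})$. Then the price of anarchy of $\boldsymbol\beta^*$, i.e. the ratio of the HTE processing cost $\sum_i\lambda_ic_i\max_{j\in r_i}V_{ij}^*$ to the minimal system processing cost, is at most \[ (K-1)\,\max_j\sqrt{\frac{\max_{i:j\in r_i}(-b'_{ij})}{\min_{i:j\in r_i}(-b'_{ij})}}+1, \] where $j$ runs over the resources used by some class. Here the minimal system processing cost is the infimum of $\sum_i\lambda_ic_i\max_{j\in r_i}W_{ij}$ over all non-anticipating scheduling policies (at each resource, a division of the capacity among the classes present that depends on the state of the network), where $W_{ij}=\mathbf E[N_{ij}]/\lambda_i$ is the steady state expected processing time of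 class $i$ at resource $j$ and $N_{ij}$ is the number of class $i$ jobs present at $j$. -/

import Mathlib

open scoped ENNReal NNReal

noncomputable section

/-- A multi-resource queueing network with `K` job classes and `J` resources of unit capacity.
Class `i` jobs arrive as a Poisson process of rate `lam i`; a class `i` job uses the nonempty set
`route i` of resources, and brings to each `j ∈ route i` an exponential workload of mean
`1 / mu j`; `c i` is its cost per unit of time.  Every resource has total load below one. -/
structure QueueNetwork (K J : ℕ) where
  lam : Fin K → ℝ
  mu : Fin J → ℝ
  c : Fin K → ℝ
  route : Fin K → Finset (Fin J)
  lam_pos : ∀ i, 0 < lam i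
  mu_pos : ∀ j, 0 < mu j
  c_pos : ∀ i, 0 < c i
  route_nonempty : ∀ i, (route i).Nonempty
  stable : ∀ j, ∑ i with j ∈ route i, lam i / mu j < 1

namespace QueueNetwork

variable {K J : ℕ} (N : QueueNetwork K J)

/-! ### The network game in heavy traffic -/

/-- The load that class `i` puts on resource `j` (used for `j ∈ route i`). -/
def load (i : Fin K) (j : Fin J) : ℝ := N.lam i / N.mu j

/-- The total load of resource `j`. -/
def totalLoad (j : Fin J) : ℝ := ∑ i with j ∈ N.route i, N.load i j

/-- `γ_j(β) = (1 / ρ_j) ∑ ρ_ij / β_ij`, over the classes `i` that use resource `j`. -/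
def gam (β : Fin K → Fin J → ℝ) (j : Fin J) : ℝ :=
  1 / N.totalLoad j * ∑ i with j ∈ N.route i, N.load i j / β i j

/-- The heavy traffic processing time at resource `j` of a single job that bids `x` there, when
the bids of the classes are `β`.  Only the bids `β i j` with `j ∈ route i` matter. -/
def htTime (β : Fin K → Fin J → ℝ) (j : Fin J) (x : ℝ) : ℝ :=
  1 / (1 - N.totalLoad j) * (1 / (N.mu j * x * N.gam β j))

/-- The total cost of a single class `i` job that bids `x j` at each resource `j` it uses, when
the bids of the classes are `β`: its time cost, which is driven by the slowest of its resources,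
plus its payments, which are equal to its bids. -/
def jobCost (β : Fin K → Fin J → ℝ) (i : Fin K) (x : Fin J → ℝ) : ℝ :=
  N.c i * (N.route i).sup' (N.route_nonempty i) (fun j => N.htTime β j (x j))
    + ∑ j ∈ N.route i, x j

/-- `β` is a heavy traffic equilibrium of the network game: for every class `i`, the bid vector of
class `i` minimizes the cost of a single class `i` job over all positive bid vectors, the bids of
all the classes being fixed at `β`. -/
def IsHTE (β : Fin K → Fin J → ℝ) : Prop :=
  ∀ i, (∀ j ∈ N.route i, 0 < β i j) ∧
    ∀ x : Fin J → ℝ, (∀ j ∈ N.route i, 0 < x j) → N.jobCost β i (β i) ≤ N.jobCost β i x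

/-- The processing cost per unit of time of the class bids `β`, in heavy traffic. -/
def htProcessingCost (β : Fin K → Fin J → ℝ) : ℝ :=
  ∑ i, N.lam i *
    (N.c i * (N.route i).sup' (N.route_nonempty i) (fun j => N.htTime β j (β i j)))

/-- `b_j(v; β)`: the positive bid `x` for which the heavy traffic processing time of a single job
at resource `j` is `v`, when the class bids are `β`. -/
def bidFor (β : Fin K → Fin J → ℝ) (j : Fin J) (v : ℝ) : ℝ :=
  Function.invFunOn (fun x => N.htTime β j x) (Set.Ioi 0) v

/-- `b'_ij`: the derivative of `b_j(·; β)` at the processing time of class `i` at resource `j`. -/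
def bidDeriv (β : Fin K → Fin J → ℝ) (i : Fin K) (j : Fin J) : ℝ :=
  deriv (fun v => N.bidFor β j v) (N.htTime β j (β i j))

/-- `max_j √(max_i (-b'_ij) / min_i (-b'_ij))`, where `i` runs over the classes that use `j`.
A resource that no class uses contributes `0` here, which does not affect the maximum as soon as
some resource is used. -/
def maxRatio (β : Fin K → Fin J → ℝ) : ℝ :=
  ⨆ j : Fin J, √((⨆ i : {i : Fin K // j ∈ N.route i}, -N.bidDeriv β i j) /
    (⨅ i : {i : Fin K // j ∈ N.route i}, -N.bidDeriv β i j))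

/-! ### Scheduling policies and the minimal processing cost -/

/-- The pairs (class, resource) such that the class uses the resource. -/
abbrev Task : Type := {p : Fin K × Fin J // p.2 ∈ N.route p.1}

/-- A state of the network: the number of jobs of each class present at each of its resources. -/
abbrev State : Type := N.Task → ℕ

/-- The change of the state at the arrival of a class `i` job, which joins all its resources
simultaneously. -/
def arrival (i : Fin K) : N.State := fun p => if p.1.1 = i then 1 else 0

/-- A (non-anticipating) scheduling policy: in state `n`, the fraction `share n p` of the capacity
of resource `p.1.2` is given to the jobs of class `p.1.1`.  No capacity goes to absent jobs, but
the policy may coordinate the resources and may leave capacity idle. -/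
structure Policy where
  share : N.State → N.Task → ℝ≥0
  share_eq_zero : ∀ n p, n p = 0 → share n p = 0
  share_le : ∀ n (j : Fin J), ∑ p : N.Task with p.1.2 = j, share n p ≤ 1

/-- `π` is a steady state distribution under the policy `φ`, that is, it satisfies the global
balance equations (outflow of `n` = inflow into `n`) of the Markov chain of the network: in state
`n`, class `i` jobs arrive at rate `lam i`, and jobs of class `p.1.1` complete at resource `p.1.2`
at rate `mu p.1.2 * share n p`. -/
def IsStationary (φ : N.Policy) (π : PMF N.State) : Prop :=
  ∀ n : N.State,
    π n * (∑ i, ENNReal.ofReal (N.lam i)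
        + ∑ p : N.Task, ENNReal.ofReal (N.mu p.1.2) * (φ.share n p : ℝ≥0∞))
      = ∑ i, (if ∀ p, N.arrival i p ≤ n p then π (n - N.arrival i) * ENNReal.ofReal (N.lam i) else 0)
        + ∑ p : N.Task, π (n + Pi.single p 1) *
            (ENNReal.ofReal (N.mu p.1.2) * (φ.share (n + Pi.single p 1) p : ℝ≥0∞))

/-- The expected number of jobs of a class at one of its resources. -/
def meanNumber (π : PMF N.State) (p : N.Task) : ℝ≥0∞ := ∑' n : N.State, π n * (n p : ℝ≥0∞)

/-- The expected processing time of a class at one of its resources, by Little's law. -/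
def meanTime (π : PMF N.State) (p : N.Task) : ℝ≥0∞ :=
  N.meanNumber π p / ENNReal.ofReal (N.lam p.1.1)

/-- The processing cost per unit of time in the steady state `π`. -/
def processingCost (π : PMF N.State) : ℝ≥0∞ :=
  ∑ i, ENNReal.ofReal (N.lam i) *
    (ENNReal.ofReal (N.c i) * ⨆ (j : Fin J) (h : j ∈ N.route i), N.meanTime π ⟨(i, j), h⟩)

/-- The minimal system processing cost, over all scheduling policies. -/
def minProcessingCost : ℝ≥0∞ :=
  ⨅ (φ : N.Policy) (π : PMF N.State) (_ : N.IsStationary φ π), N.processingCost π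

/-- The price of anarchy of the class bids `β`: the ratio of their heavy traffic processing cost
to the minimal system processing cost. -/
def priceOfAnarchy (β : Fin K → Fin J → ℝ) : ℝ≥0∞ :=
  ENNReal.ofReal (N.htProcessingCost β) / N.minProcessingCost

end QueueNetwork

end

namespace QueueNetwork

variable {K J : ℕ} (N : QueueNetwork K J)

/-! ### The structure of heavy traffic equilibria -/

/-! A bid `x` at resource `j` buys the time `A_j / x`, where `A_j` is `bidScale`. At equilibrium a
class therefore buys one common time `t_i` at all its resources, and optimality of `t_i` reads `c_i
= ∑ A_j / t_i ^ 2` (`IsHTE.cost_eq`), with summands `-b'_ij`. Hence every cost `∑ c_i x_i` splits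
over the resources into parts `A_j * ∑ x_i / t_i ^ 2`.

At each resource, `∑ lam_i t_i` equals the M/M/1 mean `ρ_j / (1 - ρ_j)`, which no policy can beat in
steady state (`IsStationary.le_sum_meanNumber`). With equal rates this says `∑ t_i ≤ ∑ w_i` for the
times `w_i` of any policy. If `T` is the largest `t_i` at the resource, then `∑ w_i / t_i ^ 2 ≥ 1 /
T`, while `∑ 1 / t_i ≤ 1 / T + (K - 1) * r / T`, where `r` bounds the ratios of the `t_i`; the
square root of the spread of `b'` is such an `r`. -/

/-- The product of a bid at resource `j` and the processing time that it buys. -/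
noncomputable def bidScale (β : Fin K → Fin J → ℝ) (j : Fin J) : ℝ :=
  1 / ((1 - N.totalLoad j) * N.mu j * N.gam β j)

/-- The processing time of class `i`, over all its resources. -/
noncomputable def classTime (β : Fin K → Fin J → ℝ) (i : Fin K) : ℝ :=
  (N.route i).sup' (N.route_nonempty i) (fun j => N.htTime β j (β i j))

variable {N} {β : Fin K → Fin J → ℝ}

lemma htTime_eq_bidScale_div (j : Fin J) (x : ℝ) : N.htTime β j x = N.bidScale β j / x := by
  simp only [htTime, bidScale, div_eq_mul_inv, mul_inv, one_mul]
  ring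

lemma load_pos (i : Fin K) (j : Fin J) : 0 < N.load i j := div_pos (N.lam_pos i) (N.mu_pos j)

lemma totalLoad_lt_one (j : Fin J) : N.totalLoad j < 1 := N.stable j

lemma totalLoad_pos {i : Fin K} {j : Fin J} (h : j ∈ N.route i) : 0 < N.totalLoad j :=
  Finset.sum_pos (fun i _ => load_pos i j) ⟨i, by simpa using h⟩

lemma IsHTE.gam_pos (hβ : N.IsHTE β) {i : Fin K} {j : Fin J} (h : j ∈ N.route i) :
    0 < N.gam β j := by
  refine mul_pos (one_div_pos.2 (totalLoad_pos h))
    (Finset.sum_pos (fun i hi => ?_) ⟨i, by simpa using h⟩)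
  exact div_pos (load_pos i j) ((hβ i).1 j (by simpa using hi))

lemma IsHTE.bidScale_pos (hβ : N.IsHTE β) {i : Fin K} {j : Fin J} (h : j ∈ N.route i) :
    0 < N.bidScale β j :=
  one_div_pos.2 (mul_pos (mul_pos (sub_pos.2 (totalLoad_lt_one j)) (N.mu_pos j)) (hβ.gam_pos h))

lemma IsHTE.classTime_pos (hβ : N.IsHTE β) (i : Fin K) : 0 < N.classTime β i := by
  obtain ⟨j, hj⟩ := N.route_nonempty i
  refine lt_of_lt_of_le ?_ (Finset.le_sup' (fun j => N.htTime β j (β i j)) hj)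
  rw [htTime_eq_bidScale_div]
  exact div_pos (hβ.bidScale_pos hj) ((hβ i).1 j hj)

/-- The cost of the cheapest bids that buy the processing time `v` at all resources. -/
lemma IsHTE.jobCost_bidScale_div (hβ : N.IsHTE β) (i : Fin K) (v : ℝ) :
    N.jobCost β i (fun j => N.bidScale β j / v)
      = N.c i * v + (∑ j ∈ N.route i, N.bidScale β j) / v := by
  have h : (N.route i).sup' (N.route_nonempty i)
      (fun j => N.htTime β j (N.bidScale β j / v)) = v := by
    rw [Finset.sup'_congr (g := fun _ => v) (N.route_nonempty i) rfl]
    · exact Finset.sup'_const _ _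
    · intro j hj
      rw [htTime_eq_bidScale_div, div_div_cancel₀ (hβ.bidScale_pos hj).ne']
  rw [jobCost, h, Finset.sum_div]

/-- Being faster at one resource than at the slowest is wasted money, so the bids are the cheapest
ones that achieve the class time. -/
lemma IsHTE.bid_eq (hβ : N.IsHTE β) {i : Fin K} {j : Fin J} (h : j ∈ N.route i) :
    β i j = N.bidScale β j / N.classTime β i := by
  have hle : ∀ j ∈ N.route i, N.bidScale β j / N.classTime β i ≤ β i j := fun j hj => by
    have h1 := Finset.le_sup' (fun j => N.htTime β j (β i j)) hj
    change N.htTime β j (β i j) ≤ N.classTime β i at h1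
    rw [htTime_eq_bidScale_div, div_le_iff₀ ((hβ i).1 j hj)] at h1
    rwa [div_le_iff₀' (hβ.classTime_pos i)]
  have h2 := (hβ i).2 (fun j => N.bidScale β j / N.classTime β i)
    (fun j hj => div_pos (hβ.bidScale_pos hj) (hβ.classTime_pos i))
  rw [hβ.jobCost_bidScale_div, Finset.sum_div] at h2
  -- Both bid vectors give the same class time, so only the payments are compared.
  have h3 : ∑ j ∈ N.route i, β i j ≤ ∑ j ∈ N.route i, N.bidScale β j / N.classTime β i :=
    le_of_add_le_add_left h2
  exact (((Finset.sum_eq_sum_iff_of_le hle).1 (le_antisymm (Finset.sum_le_sum hle) h3)) j h).symm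

lemma IsHTE.htTime_eq_classTime (hβ : N.IsHTE β) {i : Fin K} {j : Fin J} (h : j ∈ N.route i) :
    N.htTime β j (β i j) = N.classTime β i := by
  rw [htTime_eq_bidScale_div, hβ.bid_eq h, div_div_cancel₀ (hβ.bidScale_pos h).ne']

lemma eq_of_forall_mul_add_div_le {c S t : ℝ} (hc : 0 < c) (hS : 0 < S) (ht : 0 < t)
    (h : ∀ v, 0 < v → c * t + S / t ≤ c * v + S / v) : c = S / t ^ 2 := by
  -- `√(S / c)` is the minimizer of `c * v + S / v`; the excess over the minimum is a square.
  have hs : 0 < √(S / c) := Real.sqrt_pos.2 (div_pos hS hc)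
  have hsq : c * √(S / c) ^ 2 = S := by
    rw [Real.sq_sqrt (div_pos hS hc).le, mul_div_cancel₀ _ hc.ne']
  have h1 := h _ hs
  set s := √(S / c)
  have e : c * t + S / t - (c * s + S / s) = c * (t - s) ^ 2 / t := by
    rw [← hsq]; field_simp; ring
  have h2 : c * (t - s) ^ 2 / t ≤ 0 := by rw [← e]; linarith
  have h3 : (t - s) ^ 2 ≤ 0 := by
    by_contra! hpos
    exact absurd h2 (not_le.2 (by positivity))
  have h4 : t = s := sub_eq_zero.1 (sq_eq_zero_iff.1 (le_antisymm h3 (sq_nonneg _)))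
  rw [eq_div_iff (by positivity), h4, hsq]

/-- First-order condition for the class time, restricted to bids that equalize the times over the
route. -/
lemma IsHTE.cost_eq (hβ : N.IsHTE β) (i : Fin K) :
    N.c i = ∑ j ∈ N.route i, N.bidScale β j / N.classTime β i ^ 2 := by
  rw [← Finset.sum_div]
  refine eq_of_forall_mul_add_div_le (N.c_pos i)
    (Finset.sum_pos (fun j hj => hβ.bidScale_pos hj) (N.route_nonempty i)) (hβ.classTime_pos i)
    fun v hv => ?_
  rw [← hβ.jobCost_bidScale_div, ← hβ.jobCost_bidScale_div]
  refine le_trans (le_of_eq ?_) ((hβ i).2 _ fun j hj => div_pos (hβ.bidScale_pos hj) hv)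
  have h : ∀ j ∈ N.route i, N.bidScale β j / N.classTime β i = β i j := fun j hj =>
    (hβ.bid_eq hj).symm
  rw [jobCost, jobCost, Finset.sum_congr rfl h]
  congr 2
  exact Finset.sup'_congr _ rfl fun j hj => by rw [h j hj]

/-- The conservation law at a resource, in heavy traffic. -/
lemma IsHTE.sum_lam_mul_classTime (hβ : N.IsHTE β) {i : Fin K} {j : Fin J} (h : j ∈ N.route i) :
    ∑ i with j ∈ N.route i, N.lam i * N.classTime β i
      = N.totalLoad j / (1 - N.totalLoad j) := by
  have hA := hβ.bidScale_pos h
  have hg := hβ.gam_pos h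
  have hρ := totalLoad_pos h
  have hρ' := sub_pos.2 (totalLoad_lt_one (N := N) j)
  have hμ := N.mu_pos j
  have h1 : ∀ i ∈ Finset.univ.filter (fun i => j ∈ N.route i),
      N.lam i * N.classTime β i = N.mu j * N.bidScale β j * (N.load i j / β i j) := fun i hi => by
    have ht := hβ.classTime_pos i
    rw [hβ.bid_eq (by simpa using hi), load]
    field_simp
  have h2 : ∑ i with j ∈ N.route i, N.load i j / β i j = N.totalLoad j * N.gam β j := by
    rw [gam]; field_simp
  rw [Finset.sum_congr rfl h1, ← Finset.mul_sum, h2, bidScale]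
  field_simp

lemma IsHTE.neg_bidDeriv (hβ : N.IsHTE β) {i : Fin K} {j : Fin J} (h : j ∈ N.route i) :
    -N.bidDeriv β i j = N.bidScale β j / N.classTime β i ^ 2 := by
  have hA := hβ.bidScale_pos h
  have ht := hβ.classTime_pos i
  have hb : ∀ v, 0 < v → N.bidFor β j v = N.bidScale β j / v := fun v hv => by
    have hex : ∃ x ∈ Set.Ioi (0 : ℝ), N.htTime β j x = v :=
      ⟨N.bidScale β j / v, div_pos hA hv, by
        rw [htTime_eq_bidScale_div, div_div_cancel₀ hA.ne']⟩
    have hpos := Function.invFunOn_mem hex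
    have heq := Function.invFunOn_eq hex
    change N.htTime β j (N.bidFor β j v) = v at heq
    change 0 < N.bidFor β j v at hpos
    rw [htTime_eq_bidScale_div, div_eq_iff hpos.ne'] at heq
    rw [eq_div_iff hv.ne', heq, mul_comm]
  -- The inverse is explicit only for `v > 0`, but the derivative needs only a neighbourhood of the
  -- class time.
  have hev : (fun v => N.bidFor β j v) =ᶠ[nhds (N.classTime β i)]
      fun v => N.bidScale β j * v⁻¹ := by
    filter_upwards [lt_mem_nhds ht] with v hv
    rw [hb v hv, div_eq_mul_inv]
  rw [bidDeriv, hβ.htTime_eq_classTime h, hev.deriv_eq,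
    ((hasDerivAt_inv ht.ne').const_mul _).deriv]
  simp [div_eq_mul_inv]

lemma maxRatio_nonneg : 0 ≤ N.maxRatio β := Real.iSup_nonneg fun _ => Real.sqrt_nonneg _

/-- Since `-b'_ij = A_j / t_i ^ 2`, the factor `A_j` cancels in ratios at one resource, and the
square root recovers the ratio of times. -/
lemma IsHTE.classTime_le_maxRatio_mul (hβ : N.IsHTE β) {i i' : Fin K} {j : Fin J}
    (h : j ∈ N.route i) (h' : j ∈ N.route i') :
    N.classTime β i ≤ N.maxRatio β * N.classTime β i' := by
  have hA := hβ.bidScale_pos h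
  have ht := hβ.classTime_pos i
  have ht' := hβ.classTime_pos i'
  let f : {i : Fin K // j ∈ N.route i} → ℝ := fun i => -N.bidDeriv β i j
  have hf : ∀ i : {i : Fin K // j ∈ N.route i}, f i = N.bidScale β j / N.classTime β i ^ 2 :=
    fun i => hβ.neg_bidDeriv i.2
  have hsup : f ⟨i', h'⟩ ≤ ⨆ i, f i := le_ciSup (Set.finite_range f).bddAbove _
  have hinf : ⨅ i, f i ≤ f ⟨i, h⟩ := ciInf_le (Set.finite_range f).bddBelow _
  have hpos : 0 < ⨅ i, f i := by
    have : Nonempty {i : Fin K // j ∈ N.route i} := ⟨⟨i, h⟩⟩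
    obtain ⟨k, hk⟩ := exists_eq_ciInf_of_finite (f := f)
    rw [← hk, hf]
    exact div_pos hA (pow_pos (hβ.classTime_pos _) 2)
  rw [← div_le_iff₀ ht']
  calc N.classTime β i / N.classTime β i' = √(f ⟨i', h'⟩ / f ⟨i, h⟩) := by
        rw [hf, hf, eq_comm, Real.sqrt_eq_iff_mul_self_eq (by positivity) (by positivity)]
        simp only
        field_simp
    _ ≤ √((⨆ i, f i) / ⨅ i, f i) := by
        apply Real.sqrt_le_sqrt
        gcongr
        exact le_trans (by rw [hf]; positivity) hsup
    _ ≤ N.maxRatio β := le_ciSup (f := fun j : Fin J =>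
        √((⨆ i : {i : Fin K // j ∈ N.route i}, -N.bidDeriv β i j) /
          (⨅ i : {i : Fin K // j ∈ N.route i}, -N.bidDeriv β i j))) (Set.finite_range _).bddAbove j

/-- A comparison of weighted sums over a finite set in terms of the spread of the weights. -/
lemma sum_inv_le_mul_sum_div_sq {ι : Type*} {s : Finset ι} (hs : s.Nonempty) {t w : ι → ℝ}
    (ht : ∀ i ∈ s, 0 < t i) (hw : ∀ i ∈ s, 0 ≤ w i) (hsum : ∑ i ∈ s, t i ≤ ∑ i ∈ s, w i) {r n : ℝ}
    (hr : 0 ≤ r) (hratio : ∀ i ∈ s, ∀ i' ∈ s, t i ≤ r * t i') (hn : (s.card : ℝ) ≤ n) :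
    ∑ i ∈ s, 1 / t i ≤ ((n - 1) * r + 1) * ∑ i ∈ s, w i / t i ^ 2 := by
  classical
  obtain ⟨k, hk, hmax⟩ := s.exists_max_image t hs
  have htk := ht k hk
  have h1 : ∑ i ∈ s, 1 / t i ≤ ((n - 1) * r + 1) * (1 / t k) := by
    rw [← Finset.add_sum_erase s _ hk]
    -- Only the classes other than the slowest one pay the factor `r`, which gives `n - 1` instead
    -- of `n`.
    have : ∑ i ∈ s.erase k, 1 / t i ≤ (s.erase k).card • (r / t k) := by
      refine Finset.sum_le_card_nsmul _ _ _ fun i hi => ?_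
      have hi := Finset.mem_of_mem_erase hi
      rw [div_le_div_iff₀ (ht i hi) htk, one_mul]
      exact hratio k hk i hi
    rw [nsmul_eq_mul, Finset.card_erase_of_mem hk, Nat.cast_sub hs.card_pos, Nat.cast_one] at this
    have h2 : ((s.card : ℝ) - 1) * (r / t k) ≤ (n - 1) * (r / t k) := by gcongr
    calc _ ≤ 1 / t k + (n - 1) * (r / t k) := by linarith
      _ = _ := by ring
  have h2 : 1 / t k ≤ ∑ i ∈ s, w i / t i ^ 2 := by
    calc 1 / t k = t k / t k ^ 2 := by field_simp
      _ ≤ (∑ i ∈ s, w i) / t k ^ 2 := by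
          gcongr
          exact (Finset.single_le_sum (fun i hi => (ht i hi).le) hk).trans hsum
      _ ≤ _ := by
          rw [Finset.sum_div]
          refine Finset.sum_le_sum fun i hi => ?_
          have := ht i hi
          have := hw i hi
          have := hmax i hi
          gcongr
  have hn1 : (1 : ℝ) ≤ n := le_trans (by exact_mod_cast hs.card_pos) hn
  have : 0 ≤ (n - 1) * r := mul_nonneg (sub_nonneg.2 hn1) hr
  exact h1.trans (mul_le_mul_of_nonneg_left h2 (by linarith))

/-- The first-order condition turns both sides into sums over resources with common weights `A_j`,
so it suffices to compare them resource by resource. -/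
lemma IsHTE.sum_cost_mul_classTime_le (hβ : N.IsHTE β) {w : Fin K → ℝ} (hw : ∀ i, 0 ≤ w i)
    (hsum : ∀ j, ∑ i with j ∈ N.route i, N.classTime β i ≤ ∑ i with j ∈ N.route i, w i) :
    ∑ i, N.c i * N.classTime β i ≤ (((K : ℝ) - 1) * N.maxRatio β + 1) * ∑ i, N.c i * w i := by
  have key : ∀ x : Fin K → ℝ, ∑ i, N.c i * x i
      = ∑ j, N.bidScale β j * ∑ i with j ∈ N.route i, x i / N.classTime β i ^ 2 := fun x => by
    simp_rw [Finset.mul_sum, Finset.sum_filter]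
    rw [Finset.sum_comm]
    refine Finset.sum_congr rfl fun i _ => ?_
    rw [hβ.cost_eq i, Finset.sum_mul, ← Finset.sum_filter, Finset.filter_mem_eq_inter,
      Finset.univ_inter]
    exact Finset.sum_congr rfl fun j _ => by ring
  rw [key, key, Finset.mul_sum]
  refine Finset.sum_le_sum fun j _ => ?_
  rcases (Finset.univ.filter fun i => j ∈ N.route i).eq_empty_or_nonempty with h | h
  · simp [h]
  obtain ⟨i, hi⟩ := h
  have hA := hβ.bidScale_pos (by simpa using hi : j ∈ N.route i)
  rw [mul_left_comm]
  refine mul_le_mul_of_nonneg_left ?_ hA.le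
  have := sum_inv_le_mul_sum_div_sq ⟨i, hi⟩ (fun i _ => hβ.classTime_pos i) (fun i _ => hw i)
    (hsum j) maxRatio_nonneg (n := K)
    (fun i hi i' hi' => hβ.classTime_le_maxRatio_mul (by simpa using hi) (by simpa using hi'))
    (by exact_mod_cast (Finset.card_le_univ _).trans_eq (Fintype.card_fin K))
  refine le_trans (le_of_eq (Finset.sum_congr rfl fun i _ => ?_)) this
  have := hβ.classTime_pos i
  field_simp

/-! ### The workload bound for scheduling policies -/

variable (N) in
/-- The number of jobs present at resource `j`. -/
def jobsAt (j : Fin J) (n : N.State) : ℕ := ∑ p : N.Task with p.1.2 = j, n p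

lemma jobsAt_add (j : Fin J) (m n : N.State) :
    N.jobsAt j (m + n) = N.jobsAt j m + N.jobsAt j n := by
  simp [jobsAt, Finset.sum_add_distrib]

lemma jobsAt_single (j : Fin J) (p : N.Task) :
    N.jobsAt j (Pi.single p 1) = if p.1.2 = j then 1 else 0 := by
  classical
  simp [jobsAt, Pi.single_apply, Finset.sum_ite_eq']

/-- Sums over the tasks at a resource are sums over the classes that use the resource. -/
lemma sum_task_at {M : Type*} [AddCommMonoid M] (j : Fin J) (f : N.Task → M) (g : Fin K → M)
    (h : ∀ i (hi : j ∈ N.route i), f ⟨(i, j), hi⟩ = g i) :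
    ∑ p : N.Task with p.1.2 = j, f p = ∑ i with j ∈ N.route i, g i := by
  refine Finset.sum_bij (fun p _ => p.1.1) ?_ ?_ ?_ ?_
  · rintro ⟨⟨i, j'⟩, hp⟩ hj
    obtain rfl : j' = j := by simpa using hj
    simpa using hp
  · rintro ⟨⟨i, j'⟩, hp⟩ hj ⟨⟨i', j''⟩, hp'⟩ hj' hii
    simp_all
  · intro i hi
    exact ⟨⟨(i, j), by simpa using hi⟩, by simp, rfl⟩
  · rintro ⟨⟨i, j'⟩, hp⟩ hj
    obtain rfl : j' = j := by simpa using hj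
    exact h i hp

lemma jobsAt_arrival (j : Fin J) (i : Fin K) :
    N.jobsAt j (N.arrival i) = if j ∈ N.route i then 1 else 0 := by
  rw [jobsAt, sum_task_at j _ (fun i' => if i' = i then 1 else 0) (fun _ _ => rfl),
    Finset.sum_filter]
  simp only [← ite_and]
  by_cases h : j ∈ N.route i
  · rw [Finset.sum_eq_single i] <;> simp +contextual [h]
  · rw [if_neg h]
    refine Finset.sum_eq_zero fun k _ => if_neg ?_
    rintro ⟨h1, rfl⟩
    exact h h1

/-- Reindexing a sum over the states above a fixed state. -/
lemma tsum_state_shift {T : Type*} (a : T → ℕ) (F : (T → ℕ) → ℝ≥0∞)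
    [∀ n : T → ℕ, Decidable (∀ p, a p ≤ n p)] :
    ∑' n : T → ℕ, (if ∀ p, a p ≤ n p then F n else 0) = ∑' m : T → ℕ, F (m + a) := by
  rw [← (add_left_injective a).tsum_eq (f := fun n => if ∀ p, a p ≤ n p then F n else 0)]
  · refine tsum_congr fun m => ?_
    simp
  · intro n hn
    have : ∀ p, a p ≤ n p := by
      by_contra h
      simp [h] at hn
    exact ⟨n - a, funext fun p => Nat.sub_add_cancel (this p)⟩

variable {φ : N.Policy} {π : PMF N.State}

lemma Policy.share_le_one (n : N.State) (p : N.Task) : (φ.share n p : ℝ≥0∞) ≤ 1 := by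
  have := (Finset.single_le_sum (f := fun p => φ.share n p) (fun _ _ => by positivity)
    (by simp : p ∈ Finset.univ.filter fun q : N.Task => q.1.2 = p.1.2)).trans (φ.share_le n p.1.2)
  exact_mod_cast this

/-- The integrated form of the global balance equations. -/
lemma IsStationary.tsum_mul (hπ : N.IsStationary φ π) (f : N.State → ℝ≥0∞) :
    ∑ i, ENNReal.ofReal (N.lam i) * ∑' n, π n * f n
        + ∑ p : N.Task, ENNReal.ofReal (N.mu p.1.2) * ∑' n, π n * φ.share n p * f n
      = ∑ i, ENNReal.ofReal (N.lam i) * ∑' n, π n * f (n + N.arrival i)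
        + ∑ p : N.Task, ENNReal.ofReal (N.mu p.1.2) *
            ∑' n, π n * φ.share n p * f (n - Pi.single p 1) := by
  have h : ∑' n, f n * (π n * (∑ i, ENNReal.ofReal (N.lam i)
        + ∑ p : N.Task, ENNReal.ofReal (N.mu p.1.2) * (φ.share n p : ℝ≥0∞)))
      = ∑' n, f n * (∑ i, (if ∀ p, N.arrival i p ≤ n p then
          π (n - N.arrival i) * ENNReal.ofReal (N.lam i) else 0)
        + ∑ p : N.Task, π (n + Pi.single p 1) *
            (ENNReal.ofReal (N.mu p.1.2) * (φ.share (n + Pi.single p 1) p : ℝ≥0∞))) :=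
    tsum_congr fun n => by rw [hπ n]
  simp only [mul_add, Finset.mul_sum, ENNReal.tsum_add,
    Summable.tsum_finsetSum (fun _ _ => ENNReal.summable)] at h
  simp only [← ENNReal.tsum_mul_left]
  convert h using 2
  · exact Finset.sum_congr rfl fun i _ => tsum_congr fun n => by ring
  · exact Finset.sum_congr rfl fun p _ => tsum_congr fun n => by ring
  · refine Finset.sum_congr rfl fun i _ => ?_
    simp only [mul_ite, mul_zero]
    rw [tsum_state_shift (N.arrival i)
      (fun n => f n * (π (n - N.arrival i) * ENNReal.ofReal (N.lam i)))]
    refine tsum_congr fun n => ?_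
    rw [add_tsub_cancel_right]
    ring
  · refine Finset.sum_congr rfl fun p _ => ?_
    classical
    have := tsum_state_shift (Pi.single p 1) (fun n : N.State => ENNReal.ofReal (N.mu p.1.2) *
      (π n * φ.share n p * f (n - Pi.single p 1)))
    simp only [add_tsub_cancel_right] at this
    refine Eq.trans (tsum_congr fun n => ?_) (this.trans (tsum_congr fun n => by ring))
    split_ifs with hn
    · rfl
    -- Truncated subtraction does no harm: an absent task gets no capacity.
    · have : n p = 0 := by
        by_contra h0
        refine hn fun q => ?_
        by_cases hq : q = p
        · subst hq; simpa using Nat.one_le_iff_ne_zero.2 h0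
        · simp [hq]
      simp [φ.share_eq_zero n p this]

/-- The cut equation at level `k`, for the number of jobs at a resource. -/
lemma IsStationary.arrivals_eq_departures (hπ : N.IsStationary φ π) (j : Fin J) (k : ℕ) :
    (∑ i with j ∈ N.route i, ENNReal.ofReal (N.lam i)) *
        ∑' n, π n * (if N.jobsAt j n = k then 1 else 0)
      = ∑ p : N.Task with p.1.2 = j, ENNReal.ofReal (N.mu p.1.2) *
          ∑' n, π n * φ.share n p * (if N.jobsAt j n = k + 1 then 1 else 0) := by
  -- With this test function, only arrivals from level `k` and departures from level `k + 1` at `j`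
  -- survive.
  let f : N.State → ℝ≥0∞ := fun n => if N.jobsAt j n ≤ k then 1 else 0
  have hf1 : ∀ n, f n ≤ 1 := fun n => by simp only [f]; split_ifs <;> simp
  have hfin : ∀ (g : N.State → ℝ≥0∞), (∀ n, g n ≤ 1) → ∑' n, π n * g n ≠ ⊤ := fun g hg =>
    ne_top_of_le_ne_top ENNReal.one_ne_top ((ENNReal.tsum_le_tsum fun n =>
      mul_le_of_le_one_right' (hg n)).trans_eq π.tsum_coe)
  have harr : ∀ i, ∑' n, π n * f n = ∑' n, π n * f (n + N.arrival i)
      + if j ∈ N.route i then ∑' n, π n * (if N.jobsAt j n = k then 1 else 0) else 0 := fun i => by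
    split_ifs with hi
    · rw [← ENNReal.tsum_add]
      refine tsum_congr fun n => ?_
      rw [← mul_add]
      congr 1
      simp only [f, jobsAt_add, jobsAt_arrival, if_pos hi]
      split_ifs <;> first | omega | simp
    · simp [f, jobsAt_add, jobsAt_arrival, hi]
  have hdep : ∀ p : N.Task, ∑' n, π n * φ.share n p * f (n - Pi.single p 1)
      = ∑' n, π n * φ.share n p * f n + if p.1.2 = j then
        ∑' n, π n * φ.share n p * (if N.jobsAt j n = k + 1 then 1 else 0) else 0 := fun p => by
    have hjobs : ∀ n : N.State, n p ≠ 0 →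
        N.jobsAt j n = N.jobsAt j (n - Pi.single p 1) + if p.1.2 = j then 1 else 0 := fun n hn => by
      rw [← jobsAt_single, ← jobsAt_add, tsub_add_cancel_of_le]
      intro q
      by_cases hq : q = p
      · subst hq; simpa using Nat.one_le_iff_ne_zero.2 hn
      · simp [hq]
    split_ifs with hp
    · rw [← ENNReal.tsum_add]
      refine tsum_congr fun n => ?_
      rcases eq_or_ne (n p) 0 with h0 | h0
      · simp [φ.share_eq_zero n p h0]
      rw [← mul_add]
      congr 1
      have := hjobs n h0
      rw [if_pos hp] at this
      simp only [f]
      split_ifs <;> first | omega | simp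
    · rw [add_zero]
      refine tsum_congr fun n => ?_
      rcases eq_or_ne (n p) 0 with h0 | h0
      · simp [φ.share_eq_zero n p h0]
      have := hjobs n h0
      rw [if_neg hp, add_zero] at this
      simp only [f, this]
  have h := hπ.tsum_mul f
  have hrw : ∑ i, ENNReal.ofReal (N.lam i) * ∑' n, π n * f n
      = ∑ i, ENNReal.ofReal (N.lam i) * (∑' n, π n * f (n + N.arrival i)
      + if j ∈ N.route i then ∑' n, π n * (if N.jobsAt j n = k then 1 else 0) else 0) :=
    Finset.sum_congr rfl fun i _ => by rw [← harr i]
  rw [hrw] at h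
  simp only [hdep, mul_add, Finset.sum_add_distrib, mul_ite, mul_zero] at h
  simp only [← Finset.sum_filter] at h
  -- Cancellation in `ℝ≥0∞` requires the common terms to be finite, which holds because `f` and the
  -- shares are bounded by one.
  rw [add_assoc, ENNReal.add_right_inj, add_comm, ENNReal.add_right_inj] at h
  · rw [Finset.sum_mul]
    simpa only [mul_ite, mul_one, mul_zero] using h
  · refine ENNReal.sum_ne_top.2 fun p _ => ENNReal.mul_ne_top ENNReal.ofReal_ne_top ?_
    simp only [mul_assoc]
    exact hfin _ fun n => mul_le_one' (Policy.share_le_one n p) (hf1 n)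
  · exact ENNReal.sum_ne_top.2 fun i _ => ENNReal.mul_ne_top ENNReal.ofReal_ne_top
      (hfin _ fun n => hf1 _)

lemma sum_lam_eq (j : Fin J) :
    ∑ i with j ∈ N.route i, N.lam i = N.mu j * N.totalLoad j := by
  have := (N.mu_pos j).ne'
  rw [totalLoad, Finset.mul_sum]
  exact Finset.sum_congr rfl fun i _ => by rw [load]; field_simp

/-- In the cut equation the departure rate at `j` is at most `mu j`, by the capacity constraint. -/
lemma IsStationary.totalLoad_mul_le (hπ : N.IsStationary φ π) (j : Fin J) (k : ℕ) :
    ENNReal.ofReal (N.totalLoad j) * ∑' n, π n * (if N.jobsAt j n = k then 1 else 0)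
      ≤ ∑' n, π n * (if N.jobsAt j n = k + 1 then 1 else 0) := by
  have h := hπ.arrivals_eq_departures j k
  have hμ : ENNReal.ofReal (N.mu j) ≠ 0 := by simpa using N.mu_pos j
  rw [← ENNReal.mul_le_mul_iff_right hμ ENNReal.ofReal_ne_top, ← mul_assoc,
    ← ENNReal.ofReal_mul (N.mu_pos j).le, ← sum_lam_eq,
    ENNReal.ofReal_sum_of_nonneg fun i _ => (N.lam_pos i).le, h]
  calc _ = ENNReal.ofReal (N.mu j) * ∑' n, ∑ p : N.Task with p.1.2 = j,
          π n * φ.share n p * (if N.jobsAt j n = k + 1 then 1 else 0) := by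
        rw [Summable.tsum_finsetSum (fun _ _ => ENNReal.summable), Finset.mul_sum]
        refine Finset.sum_congr rfl fun p hp => ?_
        rw [(Finset.mem_filter.1 hp).2]
    _ ≤ _ := by
        gcongr with n
        rw [← Finset.sum_mul, ← Finset.mul_sum]
        gcongr
        refine mul_le_of_le_one_right' ?_
        exact_mod_cast φ.share_le n j

/-- Under any policy, resource `j` holds at least `ρ_j / (1 - ρ_j)` jobs on average. -/
lemma IsStationary.le_sum_meanNumber (hπ : N.IsStationary φ π) (j : Fin J) :
    ENNReal.ofReal (N.totalLoad j / (1 - N.totalLoad j))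
      ≤ ∑ p : N.Task with p.1.2 = j, N.meanNumber π p := by
  generalize hE : ∑ p : N.Task with p.1.2 = j, N.meanNumber π p = E
  let q : ℕ → ℝ≥0∞ := fun k => ∑' n, π n * (if N.jobsAt j n = k then 1 else 0)
  have htsum : ∀ g : ℕ → ℝ≥0∞, ∑' k, g k * q k = ∑' n, π n * g (N.jobsAt j n) := fun g => by
    simp only [q, ← ENNReal.tsum_mul_left]
    rw [ENNReal.tsum_comm]
    refine tsum_congr fun n => ?_
    rw [tsum_eq_single (N.jobsAt j n)]
    · simp [mul_comm]
    · intro k hk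
      simp [hk.symm]
  have hEq : E = ∑' k : ℕ, (k : ℝ≥0∞) * q k := by
    rw [htsum, ← hE]
    simp only [meanNumber]
    rw [← Summable.tsum_finsetSum (fun _ _ => ENNReal.summable)]
    refine tsum_congr fun n => ?_
    rw [← Finset.mul_sum, jobsAt, Nat.cast_sum]
  -- Weighting the inequality `ρ_j * q k ≤ q (k + 1)` by `k + 1` and summing makes the right side
  -- exactly `E`.
  have hrec : ENNReal.ofReal (N.totalLoad j) * (E + 1) ≤ E := by
    calc ENNReal.ofReal (N.totalLoad j) * (E + 1)
        = ENNReal.ofReal (N.totalLoad j) * ∑' k : ℕ, ((k : ℝ≥0∞) + 1) * q k := by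
          have h1 := htsum fun _ => 1
          simp only [one_mul, mul_one, π.tsum_coe] at h1
          simp only [add_mul, one_mul, ENNReal.tsum_add, h1, ← hEq]
      _ = ∑' k : ℕ, ((k : ℝ≥0∞) + 1) * (ENNReal.ofReal (N.totalLoad j) * q k) := by
          rw [← ENNReal.tsum_mul_left]
          exact tsum_congr fun k => by ring
      _ ≤ ∑' k : ℕ, ((k : ℝ≥0∞) + 1) * q (k + 1) := by
          gcongr with k
          exact hπ.totalLoad_mul_le j k
      _ = E := by
          rw [hEq, tsum_eq_zero_add' (f := fun k : ℕ => (k : ℝ≥0∞) * q k) ENNReal.summable]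
          simp
  rcases eq_or_ne E ⊤ with htop | htop
  · rw [htop]; exact le_top
  have hρ0 : 0 ≤ N.totalLoad j := Finset.sum_nonneg fun i _ => (load_pos i j).le
  have hρ1 := sub_pos.2 (totalLoad_lt_one (N := N) j)
  lift E to ℝ≥0 using htop
  rw [ENNReal.ofReal_le_iff_le_toReal ENNReal.coe_ne_top, div_le_iff₀ hρ1]
  have h := ENNReal.toReal_mono ENNReal.coe_ne_top hrec
  rw [ENNReal.toReal_mul, ENNReal.toReal_ofReal hρ0, ENNReal.toReal_add ENNReal.coe_ne_top
    ENNReal.one_ne_top, ENNReal.toReal_one] at h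
  linarith

/-! ### The price of anarchy -/

variable (N) in
/-- The steady state processing time of class `i`, over all its resources. -/
noncomputable def classMeanTime (π : PMF N.State) (i : Fin K) : ℝ≥0∞ :=
  ⨆ (j : Fin J) (h : j ∈ N.route i), N.meanTime π ⟨(i, j), h⟩

lemma meanNumber_le (π : PMF N.State) (p : N.Task) :
    N.meanNumber π p ≤ ENNReal.ofReal (N.lam p.1.1) * N.classMeanTime π p.1.1 := by
  have h : N.meanTime π p ≤ N.classMeanTime π p.1.1 :=
    le_iSup₂ (f := fun j (h : j ∈ N.route p.1.1) => N.meanTime π ⟨(p.1.1, j), h⟩) p.1.2 p.2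
  refine le_trans (le_of_eq ?_) (mul_le_mul_right h _)
  rw [meanTime, ENNReal.mul_div_cancel (by simpa using N.lam_pos _) ENNReal.ofReal_ne_top]

lemma IsHTE.htProcessingCost_le (hβ : N.IsHTE β) {lam : ℝ} (hlam : ∀ i, N.lam i = lam)
    (hK : 0 < K) (hπ : N.IsStationary φ π) :
    ENNReal.ofReal (N.htProcessingCost β)
      ≤ ENNReal.ofReal (((K : ℝ) - 1) * N.maxRatio β + 1) * N.processingCost π := by
  have hlam0 : 0 < lam := hlam ⟨0, hK⟩ ▸ N.lam_pos _
  have hR : 0 < ((K : ℝ) - 1) * N.maxRatio β + 1 := by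
    have : (1 : ℝ) ≤ K := by exact_mod_cast hK
    have := mul_nonneg (sub_nonneg.2 this) (maxRatio_nonneg (N := N) (β := β))
    linarith
  have hcost : N.processingCost π
      = ∑ i, ENNReal.ofReal lam * (ENNReal.ofReal (N.c i) * N.classMeanTime π i) := by
    simp only [processingCost, classMeanTime, hlam]
  -- An infinite mean time makes the policy's cost infinite; otherwise everything is real.
  by_cases htop : ∃ i, N.classMeanTime π i = ⊤
  · obtain ⟨i, hi⟩ := htop
    have : N.processingCost π = ⊤ := by
      rw [hcost, ENNReal.sum_eq_top]
      refine ⟨i, Finset.mem_univ i, ?_⟩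
      rw [hi, ENNReal.mul_top (by simpa using N.c_pos i), ENNReal.mul_top (by simpa using hlam0)]
    rw [this, ENNReal.mul_top (by simpa using hR)]
    exact le_top
  push Not at htop
  let w : Fin K → ℝ := fun i => (N.classMeanTime π i).toReal
  have hw : ∀ i, N.classMeanTime π i = ENNReal.ofReal (w i) := fun i =>
    (ENNReal.ofReal_toReal (htop i)).symm
  have hw0 : ∀ i, 0 ≤ w i := fun i => ENNReal.toReal_nonneg
  have hsum : ∀ j, ∑ i with j ∈ N.route i, N.classTime β i ≤ ∑ i with j ∈ N.route i, w i := by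
    intro j
    rcases (Finset.univ.filter fun i => j ∈ N.route i).eq_empty_or_nonempty with h | ⟨i, hi⟩
    · simp [h]
    have h1 := hβ.sum_lam_mul_classTime (by simpa using hi : j ∈ N.route i)
    have h2 := (hπ.le_sum_meanNumber j).trans (Finset.sum_le_sum fun p _ => meanNumber_le π p)
    rw [sum_task_at j _ (fun i => ENNReal.ofReal (lam * w i)) (fun i _ => by
      rw [hlam, hw, ENNReal.ofReal_mul hlam0.le]), ← h1,
      ← ENNReal.ofReal_sum_of_nonneg (fun i _ => mul_nonneg hlam0.le (hw0 i)),
      ENNReal.ofReal_le_ofReal_iff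
        (Finset.sum_nonneg fun i _ => mul_nonneg hlam0.le (hw0 i))] at h2
    simp only [hlam, ← Finset.mul_sum] at h2
    exact le_of_mul_le_mul_left h2 hlam0
  have hmain := hβ.sum_cost_mul_classTime_le hw0 hsum
  have hcost' : N.processingCost π = ENNReal.ofReal (lam * ∑ i, N.c i * w i) := by
    rw [hcost, Finset.mul_sum, ENNReal.ofReal_sum_of_nonneg fun i _ =>
      mul_nonneg hlam0.le (mul_nonneg (N.c_pos i).le (hw0 i))]
    refine Finset.sum_congr rfl fun i _ => ?_
    rw [hw, ENNReal.ofReal_mul hlam0.le, ENNReal.ofReal_mul (N.c_pos i).le]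
  have hht : N.htProcessingCost β = lam * ∑ i, N.c i * N.classTime β i := by
    simp only [htProcessingCost, hlam, Finset.mul_sum, classTime]
  rw [hcost', hht, ← ENNReal.ofReal_mul hR.le, mul_left_comm]
  exact ENNReal.ofReal_le_ofReal (mul_le_mul_of_nonneg_left hmain hlam0.le)

end QueueNetwork

theorem theorem13 {K J : ℕ} (N : QueueNetwork K J) (lam : ℝ) (hlam : ∀ i, N.lam i = lam)
    (β : Fin K → Fin J → ℝ) (hβ : N.IsHTE β) :
    N.priceOfAnarchy β ≤ ENNReal.ofReal (((K : ℝ) - 1) * N.maxRatio β + 1) := by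
  rcases Nat.eq_zero_or_pos K with rfl | hK
  · simp [QueueNetwork.priceOfAnarchy, QueueNetwork.htProcessingCost]
  have hR : ENNReal.ofReal (((K : ℝ) - 1) * N.maxRatio β + 1) ≠ 0 := by
    have h1 : (1 : ℝ) ≤ K := by exact_mod_cast hK
    have := mul_nonneg (sub_nonneg.2 h1) (QueueNetwork.maxRatio_nonneg (N := N) (β := β))
    simp only [ne_eq, ENNReal.ofReal_eq_zero, not_le]
    linarith
  refine ENNReal.div_le_of_le_mul ?_
  -- In this form the infimum stands alone on the right, so one policy and one steady state can be
  -- treated at a time.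
  rw [mul_comm, ← ENNReal.div_le_iff hR ENNReal.ofReal_ne_top]
  refine le_iInf fun φ => le_iInf fun π => le_iInf fun hπ => ?_
  rw [ENNReal.div_le_iff hR ENNReal.ofReal_ne_top, mul_comm]
  exact hβ.htProcessingCost_le hlam hK hπ
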